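/- Let $\Omega\subset\mathbb R^n$ be a compact convex set, let $p_1,\dots,p_k\in\mathbb R^n$ ($k\ge 1$) be distinct points, and let $\sigma:\Omega\to\mathbb R$ be a positive continuous function. Let $A_1,\dots,A_k>0$ satisfy $\sum_{i=1}^kA_i=\int_\Omega\sigma(x)\,dx$ (so $\Omega$ has non-empty interior). For $h\in\mathbb R^k$ put $$u_h(x)=\max_{1\le i\le k}\{x\cdot p_i+h_i\},\qquad W_i(h)=\{x\in\mathbb R^n: x\cdot p_i+h_i\ge x\cdot p_j+h_j\text{ for all }j\},\qquad w_i(h)=\int_{W_i(h)\cap\Omega}\sigma(x)\,dx,$$ and let $H=\{h\in\mathbb R^k:\operatorname{vol}(W_i(h)\cap\Omega)>0\text{ for all }i\}$ and $H_0=\{h\in H:\sum_{i=1}^kh_i=0\}$. Then: (1) There is $b\in\mathbb R^k$ with $w_i(b)=A_i$ for all $i$, and it is unique up to adding a constant vector: the set of all such vectors is exactly $\{b+(c,\dots,c):c\in\mathbb R\}$. (2) $H$ is open and convex. For every base point $a\in H$, the line integral in $$E(h)=\int_a^h\sum_{i=1}^kw_i\,dh_i-\sum_{i=1}^kh_iA_i\qquad(h\in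 H)$$ is the same along all $C^1$ paths in $H$ from $a$ to $h$, and the function $E$ so defined is convex on $H$ and strictly convex on $H_0$. (3) A vector $b\in\mathbb R^k$ satisfies $w_i(b)=A_i$ for all $i$ if and only if $b\in H$ and $E$ attains its minimum over $H$ at $b$. (4) For every $b$ with $w_i(b)=A_i$ for all $i$, the almost everywhere defined map $\nabla u_b$ pushes the measure $\sigma\,dx$ on $\Omega$ forward to $\sum_{i=1}^kA_i\delta_{p_i}$, and it minimizes the quadratic cost $\int_\Omega|x-T(x)|^2\sigma(x)\,dx$ among all measurable maps $T:\Omega\to\mathbb R^n$ that push $\sigma\,dx$ forward to $\sum_{i=1}^kA_i\delta_{p_i}$. -/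

import Mathlib

open MeasureTheory Set

noncomputable section

namespace SemiDiscreteOT

/-- The piecewise linear convex function `u_h(x) = max_i (x · p_i + h_i)` on `ℝⁿ`
(a maximum over the finite index set, which is non-empty when `0 < k`). -/
def potential {n k : ℕ} (p : Fin k → EuclideanSpace ℝ (Fin n)) (h : Fin k → ℝ)
    (x : EuclideanSpace ℝ (Fin n)) : ℝ :=
  ⨆ i, (inner ℝ x (p i) + h i)

/-- The closed polyhedral cell
`W_i(h) = {x | x · p_i + h_i ≥ x · p_j + h_j for all j}`. -/
def cell {n k : ℕ} (p : Fin k → EuclideanSpace ℝ (Fin n)) (h : Fin k → ℝ) (i : Fin k) :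
    Set (EuclideanSpace ℝ (Fin n)) :=
  {x | ∀ j, inner ℝ x (p j) + h j ≤ inner ℝ x (p i) + h i}

/-- The mass `w_i(h) = ∫_{W_i(h) ∩ Ω} σ(x) dx` of the `i`-th cell. -/
def cellMass {n k : ℕ} (Ω : Set (EuclideanSpace ℝ (Fin n)))
    (p : Fin k → EuclideanSpace ℝ (Fin n)) (σ : EuclideanSpace ℝ (Fin n) → ℝ)
    (h : Fin k → ℝ) (i : Fin k) : ℝ :=
  ∫ x in cell p h i ∩ Ω, σ x

/-- The set `H` of the `h ∈ ℝᵏ` for which every `W_i(h) ∩ Ω` has positive volume. -/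
def admissible {n k : ℕ} (Ω : Set (EuclideanSpace ℝ (Fin n)))
    (p : Fin k → EuclideanSpace ℝ (Fin n)) : Set (Fin k → ℝ) :=
  {h | ∀ i, 0 < volume (cell p h i ∩ Ω)}

/-- The 1-form `∑ i, w_i(h) dh_i` on `ℝᵏ`. -/
def massForm {n k : ℕ} (Ω : Set (EuclideanSpace ℝ (Fin n)))
    (p : Fin k → EuclideanSpace ℝ (Fin n)) (σ : EuclideanSpace ℝ (Fin n) → ℝ)
    (h : Fin k → ℝ) : (Fin k → ℝ) →L[ℝ] ℝ :=
  ∑ i, cellMass Ω p σ h i • ContinuousLinearMap.proj (R := ℝ) (φ := fun _ : Fin k => ℝ) i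

/-- The energy `E(h) = ∫_a^h ∑ i, w_i dh_i - ∑ i, h_i A_i` with base point `a`; the line integral
is taken along the straight segment from `a` to `h`. -/
def energy {n k : ℕ} (Ω : Set (EuclideanSpace ℝ (Fin n)))
    (p : Fin k → EuclideanSpace ℝ (Fin n)) (σ : EuclideanSpace ℝ (Fin n) → ℝ)
    (A : Fin k → ℝ) (a h : Fin k → ℝ) : ℝ :=
  curveIntegral (massForm Ω p σ) (Path.segment a h) - ∑ i, h i * A i

/-- The source measure `σ dx` on `Ω`. -/
def sourceMeasure {n : ℕ} (Ω : Set (EuclideanSpace ℝ (Fin n)))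
    (σ : EuclideanSpace ℝ (Fin n) → ℝ) : Measure (EuclideanSpace ℝ (Fin n)) :=
  (volume.restrict Ω).withDensity fun x => ENNReal.ofReal (σ x)

/-- The target measure `∑ i, A_i δ_{p_i}`. -/
def targetMeasure {n k : ℕ} (p : Fin k → EuclideanSpace ℝ (Fin n)) (A : Fin k → ℝ) :
    Measure (EuclideanSpace ℝ (Fin n)) :=
  ∑ i, ENNReal.ofReal (A i) • Measure.dirac (p i)

/-- `T` is a transport map from `μ` to `ν`: it is `μ`-measurable and pushes `μ` forward to `ν`. -/
def IsTransportMap {n : ℕ} (μ ν : Measure (EuclideanSpace ℝ (Fin n)))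
    (T : EuclideanSpace ℝ (Fin n) → EuclideanSpace ℝ (Fin n)) : Prop :=
  AEMeasurable T μ ∧ μ.map T = ν

/-- The quadratic cost `∫ |x - T(x)|² dμ(x)`, with values in `[0, ∞]`. -/
def quadraticCost {n : ℕ} (μ : Measure (EuclideanSpace ℝ (Fin n)))
    (T : EuclideanSpace ℝ (Fin n) → EuclideanSpace ℝ (Fin n)) : ENNReal :=
  ∫⁻ x, ENNReal.ofReal (‖x - T x‖ ^ 2) ∂μ

end SemiDiscreteOT

end

/-! Write `μ` for the measure σ dx on Ω and F(h) = ∫ u_h dμ. For fixed x, the function h ↦ u_h(x) is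
a maximum of affine functions, so it is convex and 1-Lipschitz. Since the p_i are distinct, ties
occur only on finitely many hyperplanes, so for almost every x its differential at h is dh_i, where
i is the cell containing x. Differentiation under the integral gives dF = ∑ w_i dh_i with continuous
coefficients (`hasFDerivAt_potentialIntegral`, `continuous_cellForm`). The form is thus exact on all
of ℝᵏ, which gives path independence, and E equals the convex function F(h) - ∑ h_i A_i up to a
constant. Its critical points, which are its global minima, are the solutions of w_i = A_i.

Existence: the energy is invariant under adding constants and controls the oscillation of h, so it
attains its minimum on a slice (`exists_measureReal_cell_eq`). Uniqueness and strict convexity: if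
convexity of F is an equality between h and h', then u_h - u_h' takes finitely many values on the
connected set Ω. It is therefore constant there, and all h_i - h'_i coincide
(`exists_sub_eq_const_of_potentialIntegral_combo`).

Optimality is duality: |x - p_i|² ≥ |x|² - 2 u_b(x) + |p_i|² + 2 b_i, with equality exactly on the
i-th cell. The right side has the same integral for every transport map
(`quadraticCost_le_of_map_eq`). -/

section

open Filter Topology

namespace SemiDiscreteOT

/-! ### Cells and the piecewise linear potential -/

section Geometry

variable {n k : ℕ} (p : Fin k → EuclideanSpace ℝ (Fin n))

theorem le_potential (h : Fin k → ℝ) (x : EuclideanSpace ℝ (Fin n)) (i : Fin k) :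
    inner ℝ x (p i) + h i ≤ potential p h x :=
  le_ciSup (f := fun i => inner ℝ x (p i) + h i) (finite_range _).bddAbove i

variable {p} in
theorem potential_eq_of_mem_cell {h : Fin k → ℝ} {i : Fin k} {x : EuclideanSpace ℝ (Fin n)}
    (hx : x ∈ cell p h i) : potential p h x = inner ℝ x (p i) + h i :=
  haveI : Nonempty (Fin k) := ⟨i⟩
  le_antisymm (ciSup_le hx) (le_potential p h x i)

theorem exists_mem_cell [Nonempty (Fin k)] (h : Fin k → ℝ) (x : EuclideanSpace ℝ (Fin n)) :
    ∃ i, x ∈ cell p h i :=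
  Finite.exists_max fun i => inner ℝ x (p i) + h i

theorem isClosed_cell (h : Fin k → ℝ) (i : Fin k) : IsClosed (cell p h i) := by
  simp only [cell, ofPred_forall]
  exact isClosed_iInter fun j => isClosed_le (by fun_prop) (by fun_prop)

theorem measurableSet_cell (h : Fin k → ℝ) (i : Fin k) : MeasurableSet (cell p h i) :=
  (isClosed_cell p h i).measurableSet

theorem potential_le_add_norm [Nonempty (Fin k)] (h h' : Fin k → ℝ)
    (x : EuclideanSpace ℝ (Fin n)) : potential p h x ≤ potential p h' x + ‖h - h'‖ := by
  refine ciSup_le fun i => ?_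
  have h1 := le_potential p h' x i
  have h2 := (le_abs_self _).trans (norm_le_pi_norm (h - h') i)
  simp only [Pi.sub_apply] at h2
  linarith

theorem lipschitzWith_potential [Nonempty (Fin k)] (x : EuclideanSpace ℝ (Fin n)) :
    LipschitzWith 1 fun h => potential p h x :=
  LipschitzWith.of_le_add fun h h' => by
    rw [dist_eq_norm]; exact potential_le_add_norm p h h' x

theorem continuous_potential [Nonempty (Fin k)] (h : Fin k → ℝ) : Continuous (potential p h) := by
  have : potential p h = fun x => Finset.univ.sup' Finset.univ_nonempty
      fun i => inner ℝ x (p i) + h i := by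
    ext x; rw [Finset.sup'_univ_eq_ciSup]; rfl
  rw [this]
  exact Continuous.finset_sup'_apply _ fun i _ => by fun_prop

theorem potential_add_const [Nonempty (Fin k)] (h : Fin k → ℝ) (c : ℝ)
    (x : EuclideanSpace ℝ (Fin n)) :
    potential p (fun i => h i + c) x = potential p h x + c := by
  obtain ⟨i, hi⟩ := exists_mem_cell p h x
  have : x ∈ cell p (fun i => h i + c) i := fun j => by have := hi j; dsimp only; linarith
  rw [potential_eq_of_mem_cell this, potential_eq_of_mem_cell hi, add_assoc]

theorem cell_add_const (h : Fin k → ℝ) (c : ℝ) (i : Fin k) :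
    cell p (fun i => h i + c) i = cell p h i := by
  ext x
  simp only [cell, mem_ofPred_eq, ← add_assoc, add_le_add_iff_right]

theorem potential_combo_le [Nonempty (Fin k)] (h h' : Fin k → ℝ) (x : EuclideanSpace ℝ (Fin n))
    {s t : ℝ} (hs : 0 ≤ s) (ht : 0 ≤ t) (hst : s + t = 1) :
    potential p (s • h + t • h') x ≤ s * potential p h x + t * potential p h' x := by
  refine ciSup_le fun i => ?_
  have h1 := mul_le_mul_of_nonneg_left (le_potential p h x i) hs
  have h2 := mul_le_mul_of_nonneg_left (le_potential p h' x i) ht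
  have h3 : inner ℝ x (p i) = s * inner ℝ x (p i) + t * inner ℝ x (p i) := by
    rw [← add_mul, hst, one_mul]
  simp only [Pi.add_apply, Pi.smul_apply, smul_eq_mul]
  linarith

/-- Where the convexity inequality of the potential is an equality, a maximizing index for the
convex combination is maximizing for both ends. -/
theorem potential_sub_eq_of_combo_eq {h h' : Fin k → ℝ} {x : EuclideanSpace ℝ (Fin n)} {i : Fin k}
    {s t : ℝ} (hs : 0 < s) (ht : 0 < t) (hst : s + t = 1)
    (heq : potential p (s • h + t • h') x = s * potential p h x + t * potential p h' x)
    (hx : x ∈ cell p (s • h + t • h') i) :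
    potential p h x - potential p h' x = h i - h' i := by
  rw [potential_eq_of_mem_cell hx] at heq
  simp only [Pi.add_apply, Pi.smul_apply, smul_eq_mul] at heq
  have h1 := le_potential p h x i
  have h2 := le_potential p h' x i
  have h3 : inner ℝ x (p i) = s * inner ℝ x (p i) + t * inner ℝ x (p i) := by
    rw [← add_mul, hst, one_mul]
  have h4 := mul_le_mul_of_nonneg_left h1 hs.le
  have h5 := mul_le_mul_of_nonneg_left h2 ht.le
  have h6 : s * potential p h x = s * (inner ℝ x (p i) + h i) := by linarith
  have h7 : t * potential p h' x = t * (inner ℝ x (p i) + h' i) := by linarith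
  linarith [mul_left_cancel₀ hs.ne' h6, mul_left_cancel₀ ht.ne' h7]

variable {p} in
-- Joint openness in heights and points serves both the derivative in h and the gradient in x.
theorem eventually_mem_cell {h : Fin k → ℝ} {x : EuclideanSpace ℝ (Fin n)} {i : Fin k}
    (hx : ∀ j, j ≠ i → inner ℝ x (p j) + h j < inner ℝ x (p i) + h i) :
    ∀ᶠ q : (Fin k → ℝ) × EuclideanSpace ℝ (Fin n) in 𝓝 (h, x), q.2 ∈ cell p q.1 i := by
  simp only [cell, mem_ofPred_eq, eventually_all]
  intro j
  rcases eq_or_ne j i with rfl | hj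
  · exact Eventually.of_forall fun _ => le_rfl
  · have hl : ContinuousAt (fun q : (Fin k → ℝ) × EuclideanSpace ℝ (Fin n) =>
        inner ℝ q.2 (p j) + q.1 j) (h, x) := by fun_prop
    have hr : ContinuousAt (fun q : (Fin k → ℝ) × EuclideanSpace ℝ (Fin n) =>
        inner ℝ q.2 (p i) + q.1 i) (h, x) := by fun_prop
    exact (hl.eventually_lt hr (hx j hj)).mono fun _ => le_of_lt

variable {p} in
theorem hasFDerivAt_potential {h : Fin k → ℝ} {x : EuclideanSpace ℝ (Fin n)} {i : Fin k}
    (hx : ∀ j, j ≠ i → inner ℝ x (p j) + h j < inner ℝ x (p i) + h i) :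
    HasFDerivAt (fun h' => potential p h' x)
      (ContinuousLinearMap.proj (R := ℝ) (φ := fun _ : Fin k => ℝ) i) h := by
  have h1 : HasFDerivAt (fun h' : Fin k → ℝ => inner ℝ x (p i) + h' i)
      (ContinuousLinearMap.proj (R := ℝ) (φ := fun _ : Fin k => ℝ) i) h :=
    (ContinuousLinearMap.proj (R := ℝ) (φ := fun _ : Fin k => ℝ) i).hasFDerivAt.const_add _
  refine h1.congr_of_eventuallyEq ?_
  have h2 : Tendsto (fun h' : Fin k → ℝ => (h', x)) (𝓝 h) (𝓝 (h, x)) :=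
    ContinuousAt.tendsto (f := fun h' : Fin k → ℝ => (h', x)) (by fun_prop)
  filter_upwards [h2.eventually (eventually_mem_cell hx)] with h' hh'
  exact potential_eq_of_mem_cell hh'

variable {p} in
theorem gradient_potential {h : Fin k → ℝ} {x : EuclideanSpace ℝ (Fin n)} {i : Fin k}
    (hx : ∀ j, j ≠ i → inner ℝ x (p j) + h j < inner ℝ x (p i) + h i) :
    gradient (potential p h) x = p i := by
  apply HasGradientAt.gradient
  have h1 : HasFDerivAt (fun y => inner ℝ y (p i) + h i)
      (InnerProductSpace.toDual ℝ (EuclideanSpace ℝ (Fin n)) (p i)) x := by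
    have := ((InnerProductSpace.toDual ℝ (EuclideanSpace ℝ (Fin n)) (p i)).hasFDerivAt
      (x := x)).add_const (h i)
    refine this.congr_of_eventuallyEq (Eventually.of_forall fun y => ?_)
    simp [real_inner_comm]
  refine HasFDerivAt.congr_of_eventuallyEq h1 ?_
  have h2 : Tendsto (fun y => (h, y)) (𝓝 x) (𝓝 (h, x)) :=
    ContinuousAt.tendsto (f := fun y : EuclideanSpace ℝ (Fin n) => (h, y)) (by fun_prop)
  filter_upwards [h2.eventually (eventually_mem_cell hx)] with y hy
  exact potential_eq_of_mem_cell hy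

theorem volume_hyperplane {v : EuclideanSpace ℝ (Fin n)} (hv : v ≠ 0) (c : ℝ) :
    volume {x : EuclideanSpace ℝ (Fin n) | inner ℝ x v = c} = 0 := by
  by_cases hne : ∃ y : EuclideanSpace ℝ (Fin n), inner ℝ y v = c
  · obtain ⟨y, hy⟩ := hne
    have hset : {x : EuclideanSpace ℝ (Fin n) | inner ℝ x v = c} =
        (AffineSubspace.mk' y (LinearMap.ker (innerₗ (EuclideanSpace ℝ (Fin n)) v)) :
          AffineSubspace ℝ (EuclideanSpace ℝ (Fin n))) := by
      ext x
      simp [AffineSubspace.mem_mk', inner_sub_right, real_inner_comm, ← hy, sub_eq_zero]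
    rw [hset]
    refine Measure.addHaar_affineSubspace _ _ fun htop => hv ?_
    have := congrArg AffineSubspace.direction htop
    rw [AffineSubspace.direction_mk', AffineSubspace.direction_top] at this
    have hv' : v ∈ LinearMap.ker (innerₗ (EuclideanSpace ℝ (Fin n)) v) := this ▸ trivial
    simpa using hv'
  · have : {x : EuclideanSpace ℝ (Fin n) | inner ℝ x v = c} = ∅ :=
      eq_empty_of_forall_notMem fun x hx => hne ⟨x, hx⟩
    rw [this, measure_empty]

variable {p} in
theorem ae_affine_ne (hp : Function.Injective p) (h : Fin k → ℝ) :
    ∀ᵐ x : EuclideanSpace ℝ (Fin n), ∀ i j, i ≠ j →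
      inner ℝ x (p i) + h i ≠ inner ℝ x (p j) + h j := by
  simp only [eventually_all]
  intro i j hij
  rw [ae_iff]
  refine measure_mono_null (fun x hx => ?_)
    (volume_hyperplane (sub_ne_zero.mpr (hp.ne hij)) (h j - h i))
  simp only [ne_eq, not_not, mem_ofPred_eq, inner_sub_right] at hx ⊢
  linarith

variable {p} in
/-- Almost every point lies in a single cell, strictly inside. -/
theorem ae_exists_unique_max [Nonempty (Fin k)] (hp : Function.Injective p) (h : Fin k → ℝ) :
    ∀ᵐ x : EuclideanSpace ℝ (Fin n), ∃ i, x ∈ cell p h i ∧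
      ∀ j, j ≠ i → inner ℝ x (p j) + h j < inner ℝ x (p i) + h i := by
  filter_upwards [ae_affine_ne hp h] with x hx
  obtain ⟨i, hi⟩ := exists_mem_cell p h x
  exact ⟨i, hi, fun j hj => (hi j).lt_of_ne (hx j i hj)⟩

/-- Fix a point y of the cell for h'. The homothety with centre y and ratio s sends the cell for h
into the cell for the combination, because the defining inequalities are jointly linear in (x, h) up
to the products x · p_j, which are linear in x. It multiplies volume by sⁿ > 0. -/
theorem convex_admissible {Ω : Set (EuclideanSpace ℝ (Fin n))} (hΩ : Convex ℝ Ω) :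
    Convex ℝ (admissible Ω p) := by
  refine convex_iff_forall_pos.mpr fun h hh h' hh' s t hs ht hst i => ?_
  obtain ⟨y, hy⟩ := nonempty_of_measure_ne_zero (hh' i).ne'
  refine lt_of_lt_of_le ?_ (measure_mono (μ := volume)
    (s := AffineMap.homothety y s '' (cell p h i ∩ Ω)) ?_)
  · rw [Measure.addHaar_image_homothety]
    exact ENNReal.mul_pos (by simp [hs.ne']) (hh i).ne'
  · rintro _ ⟨x, hx, rfl⟩
    have hz : AffineMap.homothety y s x = s • x + t • y := by
      rw [AffineMap.homothety_apply, eq_sub_of_add_eq' hst]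
      simp only [vsub_eq_sub, vadd_eq_add, smul_sub, sub_smul, one_smul]
      abel
    rw [hz]
    refine ⟨fun j => ?_, hΩ hx.2 hy.2 hs.le ht.le hst⟩
    have h1 := mul_le_mul_of_nonneg_left (hx.1 j) hs.le
    have h2 := mul_le_mul_of_nonneg_left (hy.1 j) ht.le
    simp only [inner_add_left, real_inner_smul_left, Pi.add_apply, Pi.smul_apply, smul_eq_mul]
    linarith

end Geometry

end SemiDiscreteOT

/-! ### Line integrals of exact forms and integrals of step functions -/

theorem curveIntegral_eq_sub_of_hasFDerivAt {E F : Type*} [NormedAddCommGroup E]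
    [NormedSpace ℝ E] [NormedAddCommGroup F] [NormedSpace ℝ F] [CompleteSpace F]
    {f : E → F} {ω : E → E →L[ℝ] F} (hf : ∀ x, HasFDerivAt f (ω x) x) (hω : Continuous ω)
    {a b : E} {γ : Path a b} (hγ : ContDiffOn ℝ 1 γ.extend (Icc 0 1)) :
    CurveIntegrable ω γ ∧ curveIntegral ω γ = f b - f a := by
  have hint : CurveIntegrable ω γ :=
    hω.continuousOn.curveIntegrable_of_contDiffOn (s := univ) hγ fun _ => trivial
  refine ⟨hint, ?_⟩
  have hfc : Continuous f := continuous_iff_continuousAt.mpr fun x => (hf x).continuousAt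
  have key := intervalIntegral.integral_eq_sub_of_hasDerivAt_of_le (f := fun t => f (γ.extend t))
    (f' := curveIntegralFun ω γ) zero_le_one (by fun_prop) (fun t ht => ?_) hint
  · rw [curveIntegral_def, key]; simp
  · rw [curveIntegralFun_def]
    have hnhds : Icc (0 : ℝ) 1 ∈ 𝓝 t := Icc_mem_nhds ht.1 ht.2
    have hd : DifferentiableAt ℝ γ.extend t :=
      ((hγ.differentiableOn one_ne_zero) t (Ioo_subset_Icc_self ht)).differentiableAt hnhds
    rw [derivWithin_of_mem_nhds hnhds]
    exact (hf _).comp_hasDerivAt t hd.hasDerivAt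

theorem integrable_and_integral_sum_indicator_smul {α ι G : Type*} [MeasurableSpace α] [Fintype ι]
    [NormedAddCommGroup G] [NormedSpace ℝ G] [CompleteSpace G] {μ : Measure α} [IsFiniteMeasure μ]
    {s : ι → Set α} (hs : ∀ i, MeasurableSet (s i)) (v : ι → G) :
    Integrable (fun x => ∑ i, (s i).indicator (fun _ => (1 : ℝ)) x • v i) μ ∧
      ∫ x, ∑ i, (s i).indicator (fun _ => (1 : ℝ)) x • v i ∂μ = ∑ i, μ.real (s i) • v i := by
  have hone : ∀ i, Integrable ((s i).indicator fun _ => (1 : ℝ)) μ := fun i =>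
    (integrable_const _).indicator (hs i)
  have hind : ∀ i ∈ Finset.univ, Integrable (fun x => (s i).indicator
      (fun _ => (1 : ℝ)) x • v i) μ := fun i _ => (hone i).smul_const _
  refine ⟨integrable_finsetSum _ hind, ?_⟩
  rw [integral_finsetSum _ hind]
  refine Finset.sum_congr rfl fun i _ => ?_
  rw [integral_smul_const, integral_indicator_const _ (hs i), smul_eq_mul, mul_one]

/-! ### The integrated potential: derivative, convexity and equality case -/

namespace SemiDiscreteOT

/-- The integral of the potential against `μ`, as a function of the height vector. -/
noncomputable def potentialIntegral {n k : ℕ} (μ : Measure (EuclideanSpace ℝ (Fin n)))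
    (p : Fin k → EuclideanSpace ℝ (Fin n)) (h : Fin k → ℝ) : ℝ :=
  ∫ x, potential p h x ∂μ

/-- The 1-form `∑ i, μ (cell i) dh_i`. -/
noncomputable def cellForm {n k : ℕ} (μ : Measure (EuclideanSpace ℝ (Fin n)))
    (p : Fin k → EuclideanSpace ℝ (Fin n)) (h : Fin k → ℝ) : (Fin k → ℝ) →L[ℝ] ℝ :=
  ∑ i, μ.real (cell p h i) • ContinuousLinearMap.proj (R := ℝ) (φ := fun _ : Fin k => ℝ) i

section FiniteMeasure

variable {n k : ℕ} {p : Fin k → EuclideanSpace ℝ (Fin n)}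
  {μ : Measure (EuclideanSpace ℝ (Fin n))} {Ω : Set (EuclideanSpace ℝ (Fin n))}

theorem integrable_of_continuous_of_isCompact [IsFiniteMeasure μ] (hΩ : IsCompact Ω)
    (hμΩ : ∀ᵐ x ∂μ, x ∈ Ω) {f : EuclideanSpace ℝ (Fin n) → ℝ} (hf : Continuous f) :
    Integrable f μ := by
  obtain ⟨C, hC⟩ := hΩ.exists_bound_of_continuousOn hf.continuousOn
  exact Integrable.of_bound hf.aestronglyMeasurable C (hμΩ.mono hC)

/-- Off the tie hyperplanes of h, membership of x in a cell is locally constant in the heights near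
h, so the indicators converge almost everywhere. -/
theorem continuous_measure_cell [Nonempty (Fin k)] [IsFiniteMeasure μ] (hμ : μ ≪ volume)
    (hp : Function.Injective p) (i : Fin k) : Continuous fun h => μ (cell p h i) := by
  refine continuous_iff_continuousAt.mpr fun h => ?_
  refine tendsto_measure_of_ae_tendsto_indicator_of_isFiniteMeasure (𝓝 h)
    (measurableSet_cell p h i) (fun h' => measurableSet_cell p h' i) ?_
  filter_upwards [hμ.ae_le (ae_exists_unique_max hp h)] with x hx
  obtain ⟨j, hj, hlt⟩ := hx
  by_cases hij : j = i
  · subst hij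
    have h2 : Tendsto (fun h' : Fin k → ℝ => (h', x)) (𝓝 h) (𝓝 (h, x)) :=
      ContinuousAt.tendsto (f := fun h' : Fin k → ℝ => (h', x)) (by fun_prop)
    filter_upwards [h2.eventually (eventually_mem_cell hlt)] with h' hh'
    exact iff_of_true hh' hj
  · have hcont : ∀ l, ContinuousAt (fun h' : Fin k → ℝ => inner ℝ x (p l) + h' l) h :=
      fun l => (continuous_const.add (continuous_apply l)).continuousAt
    filter_upwards [(hcont i).eventually_lt (hcont j) (hlt i (Ne.symm hij))] with h' hh'
    exact iff_of_false (fun hx' => (hx' j).not_gt hh') fun hx' =>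
      (hx' j).not_gt (hlt i (Ne.symm hij))

theorem continuous_cellForm [Nonempty (Fin k)] [IsFiniteMeasure μ] (hμ : μ ≪ volume)
    (hp : Function.Injective p) : Continuous (cellForm μ p) := by
  have hreal : ∀ i, Continuous fun h => μ.real (cell p h i) := fun i =>
    ENNReal.continuousOn_toReal.comp_continuous (continuous_measure_cell hμ hp i)
      fun h => measure_ne_top _ _
  unfold cellForm
  fun_prop

/-- Differentiation under the integral: the Lipschitz constant 1 dominates, and the pointwise
differential exists off the ties. -/
theorem hasFDerivAt_potentialIntegral [Nonempty (Fin k)] [IsFiniteMeasure μ] (hμ : μ ≪ volume)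
    (hp : Function.Injective p) (hΩ : IsCompact Ω) (hμΩ : ∀ᵐ x ∂μ, x ∈ Ω) (h : Fin k → ℝ) :
    HasFDerivAt (potentialIntegral μ p) (cellForm μ p h) h := by
  set D : EuclideanSpace ℝ (Fin n) → ((Fin k → ℝ) →L[ℝ] ℝ) := fun x =>
    ∑ i, (cell p h i).indicator (fun _ => (1 : ℝ)) x •
      ContinuousLinearMap.proj (R := ℝ) (φ := fun _ : Fin k => ℝ) i with hD
  obtain ⟨hDint, hint⟩ := integrable_and_integral_sum_indicator_smul (μ := μ)
    (fun i => measurableSet_cell p h i)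
    (fun i => ContinuousLinearMap.proj (R := ℝ) (φ := fun _ : Fin k => ℝ) i)
  rw [cellForm, ← hint]
  have hlip : ∀ᵐ x ∂μ, ∀ h' ∈ (univ : Set (Fin k → ℝ)),
      ‖potential p h' x - potential p h x‖ ≤ 1 * ‖h' - h‖ :=
    Eventually.of_forall fun x h' _ => (lipschitzWith_potential p x).norm_sub_le h' h
  have hdiff : ∀ᵐ x ∂μ, HasFDerivAt (fun h' => potential p h' x) (D x) h := by
    filter_upwards [hμ.ae_le (ae_exists_unique_max hp h)] with x hx
    obtain ⟨i, hi, hlt⟩ := hx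
    have hDx : D x = ContinuousLinearMap.proj (R := ℝ) (φ := fun _ : Fin k => ℝ) i := by
      simp only [hD]
      rw [Finset.sum_eq_single i, indicator_of_mem hi, one_smul]
      · intro j _ hj
        rw [indicator_of_notMem fun hxj => (hxj i).not_gt (hlt j hj), zero_smul]
      · simp
    rw [hDx]
    exact hasFDerivAt_potential hlt
  exact (hasFDerivAt_integral_of_dominated_loc_of_lip' (F := potential p) (bound := fun _ => 1)
    univ_mem (fun h' _ => (continuous_potential p h').aestronglyMeasurable)
    (integrable_of_continuous_of_isCompact hΩ hμΩ (continuous_potential p h))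
    hDint.aestronglyMeasurable hlip (integrable_const _) hdiff).2

theorem convexOn_potentialIntegral [Nonempty (Fin k)] [IsFiniteMeasure μ] (hΩ : IsCompact Ω)
    (hμΩ : ∀ᵐ x ∂μ, x ∈ Ω) : ConvexOn ℝ univ (potentialIntegral μ p) := by
  refine ⟨convex_univ, fun h _ h' _ s t hs ht hst => ?_⟩
  have hi : ∀ h, Integrable (potential p h) μ := fun h =>
    integrable_of_continuous_of_isCompact hΩ hμΩ (continuous_potential p h)
  simp only [potentialIntegral, smul_eq_mul]
  rw [← integral_const_mul, ← integral_const_mul,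
    ← integral_add ((hi h).const_mul s) ((hi h').const_mul t)]
  exact integral_mono (hi _) (((hi h).const_mul s).add ((hi h').const_mul t)) fun x =>
    potential_combo_le p h h' x hs ht hst

theorem potentialIntegral_add_const [Nonempty (Fin k)] [IsFiniteMeasure μ] (hΩ : IsCompact Ω)
    (hμΩ : ∀ᵐ x ∂μ, x ∈ Ω) (h : Fin k → ℝ) (c : ℝ) :
    potentialIntegral μ p (fun i => h i + c) = potentialIntegral μ p h + μ.real univ * c := by
  simp only [potentialIntegral, potential_add_const]
  rw [integral_add (integrable_of_continuous_of_isCompact hΩ hμΩ (continuous_potential p h))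
    (integrable_const _), integral_const, smul_eq_mul]

/-- Two height vectors between which the potential integral is not strictly convex differ by a
constant vector. -/
theorem exists_sub_eq_const_of_potentialIntegral_combo [Nonempty (Fin k)] [IsFiniteMeasure μ]
    (hΩ : IsCompact Ω) (hconv : Convex ℝ Ω) (hμΩ : ∀ᵐ x ∂μ, x ∈ Ω)
    (hΩμ : volume.restrict Ω ≪ μ) {h h' : Fin k → ℝ} (hh : h ∈ admissible Ω p)
    (hh' : h' ∈ admissible Ω p) {s t : ℝ} (hs : 0 < s) (ht : 0 < t) (hst : s + t = 1)
    (hle : s * potentialIntegral μ p h + t * potentialIntegral μ p h' ≤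
      potentialIntegral μ p (s • h + t • h')) :
    ∃ c, ∀ i, h i - h' i = c := by
  have hi : ∀ h, Integrable (potential p h) μ := fun h =>
    integrable_of_continuous_of_isCompact hΩ hμΩ (continuous_potential p h)
  have hcomb := potential_combo_le p h h' (hs := hs.le) (ht := ht.le) (hst := hst)
  have hae : potential p (s • h + t • h') =ᵐ[μ]
      fun x => s * potential p h x + t * potential p h' x := by
    have hir := ((hi h).const_mul s).add ((hi h').const_mul t)
    refine (integral_eq_iff_of_ae_le (hi _) hir (Eventually.of_forall hcomb)).mp ?_
    refine le_antisymm (integral_mono (hi _) hir hcomb) ?_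
    have : ∫ x, ((fun x => s * potential p h x) + fun x => t * potential p h' x) x ∂μ =
        s * potentialIntegral μ p h + t * potentialIntegral μ p h' := by
      rw [integral_add' ((hi h).const_mul s) ((hi h').const_mul t), integral_const_mul,
        integral_const_mul]
      rfl
    exact this.trans_le hle
  -- A convex set with empty interior lies in its own frontier, which is null, against the positive
  -- volume of the cells.
  have hint : (interior Ω).Nonempty := by
    by_contra hemp
    obtain ⟨i⟩ := ‹Nonempty (Fin k)›
    refine (hh i).ne' (measure_mono_null (inter_subset_right.trans fun x hx => ?_)
      (hconv.addHaar_frontier volume))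
    rw [frontier, not_nonempty_iff_eq_empty.mp hemp, sdiff_empty]
    exact subset_closure hx
  -- Continuity upgrades the almost everywhere equality to all of Ω, since Ω lies in the closure of
  -- its interior.
  have heq : EqOn (potential p (s • h + t • h'))
      (fun x => s * potential p h x + t * potential p h' x) Ω := by
    refine Measure.eqOn_of_ae_eq (μ := volume) (hΩμ.ae_le hae)
      (continuous_potential p _).continuousOn
      ((continuous_const.mul (continuous_potential p h)).add
        (continuous_const.mul (continuous_potential p h'))).continuousOn ?_
    rw [hconv.closure_interior_eq_closure_of_nonempty_interior hint]
    exact subset_closure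
  set d : EuclideanSpace ℝ (Fin n) → ℝ := fun x => potential p h x - potential p h' x with hd
  have hval : ∀ x ∈ Ω, ∀ i, x ∈ cell p (s • h + t • h') i → d x = h i - h' i :=
    fun x hx i hxi => potential_sub_eq_of_combo_eq p hs ht hst (heq hx) hxi
  -- A finite continuous image of a connected set has at most one point.
  have hsub : (d '' Ω).Subsingleton := by
    have hfin : (d '' Ω).Finite := by
      refine (finite_range fun i => h i - h' i).subset ?_
      rintro _ ⟨x, hx, rfl⟩
      obtain ⟨i, hxi⟩ := exists_mem_cell p (s • h + t • h') x
      exact ⟨i, (hval x hx i hxi).symm⟩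
    exact hfin.countable.isTotallyDisconnected _ subset_rfl (hconv.isPreconnected.image d
      ((continuous_potential p h).sub (continuous_potential p h')).continuousOn)
  -- Every difference is attained: the combination is again admissible, so each of its cells meets
  -- Ω.
  have hmem : ∀ i, h i - h' i ∈ d '' Ω := fun i => by
    obtain ⟨x, hx, hxΩ⟩ := nonempty_of_measure_ne_zero
      (convex_admissible p hconv hh hh' hs.le ht.le hst i).ne'
    exact ⟨x, hxΩ, hval x hxΩ i hx⟩
  obtain ⟨i₀⟩ := ‹Nonempty (Fin k)›
  exact ⟨h i₀ - h' i₀, fun i => hsub (hmem i) (hmem i₀)⟩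

end FiniteMeasure

end SemiDiscreteOT

theorem ConvexOn.le_of_hasFDerivAt_zero {E : Type*} [NormedAddCommGroup E] [NormedSpace ℝ E]
    {f : E → ℝ} (hf : ConvexOn ℝ univ f) {b : E} (hb : HasFDerivAt f (0 : E →L[ℝ] ℝ) b) (x : E) :
    f b ≤ f x := by
  have hline : HasDerivAt (fun t : ℝ => f (AffineMap.lineMap b x t)) 0 0 := by
    have h1 : HasDerivAt (AffineMap.lineMap b x : ℝ → E) (x - b) 0 := AffineMap.hasDerivAt_lineMap
    have h2 : HasFDerivAt f (0 : E →L[ℝ] ℝ) (AffineMap.lineMap b x (0 : ℝ)) := by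
      rwa [AffineMap.lineMap_apply_zero]
    have h3 := h2.comp_hasDerivAt (0 : ℝ) h1
    rwa [zero_apply] at h3
  have hconv : ConvexOn ℝ univ (fun t : ℝ => f (AffineMap.lineMap b x t)) :=
    hf.comp_affineMap (AffineMap.lineMap b x)
  have := hconv.le_slope_of_hasDerivAt (mem_univ 0) (mem_univ 1) zero_lt_one hline
  simpa [slope_def_field] using this

/-! ### The reduced energy, its minimizers, and optimality of the transport -/

namespace SemiDiscreteOT

/-- The reduced energy: the potential integral minus the linear functional given by the target
masses. -/
noncomputable def reducedEnergy (μ : Measure (EuclideanSpace ℝ (Fin n)))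
    (p : Fin k → EuclideanSpace ℝ (Fin n)) (A : Fin k → ℝ) (h : Fin k → ℝ) : ℝ :=
  potentialIntegral μ p h - ∑ i, h i * A i

section Basic

variable {n k : ℕ} {p : Fin k → EuclideanSpace ℝ (Fin n)}
  {μ : Measure (EuclideanSpace ℝ (Fin n))} {A : Fin k → ℝ}

theorem hasFDerivAt_sum_mul (A h : Fin k → ℝ) : HasFDerivAt (fun h : Fin k → ℝ => ∑ i, h i * A i)
    (∑ i, A i • ContinuousLinearMap.proj (R := ℝ) (φ := fun _ : Fin k => ℝ) i) h := by
  refine HasFDerivAt.fun_sum fun i _ => ?_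
  exact ((ContinuousLinearMap.proj (R := ℝ) (φ := fun _ : Fin k => ℝ) i).hasFDerivAt
    (x := h)).mul_const (A i)

theorem cellForm_sub_eq_zero_iff {h : Fin k → ℝ} : cellForm μ p h -
      ∑ i, A i • ContinuousLinearMap.proj (R := ℝ) (φ := fun _ : Fin k => ℝ) i = 0 ↔
    ∀ i, μ.real (cell p h i) = A i := by
  rw [sub_eq_zero]
  refine ⟨fun heq i => ?_, fun heq => by simp only [cellForm, heq]⟩
  have := DFunLike.congr_fun heq (Pi.single i 1)
  simpa [cellForm, sum_apply, Pi.single_apply] using this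

theorem ae_gradient_potential (hμ : μ ≪ volume) (hp : Function.Injective p) (b : Fin k → ℝ) :
    ∀ᵐ x ∂μ, ∀ i, x ∈ cell p b i → gradient (potential p b) x = p i := by
  filter_upwards [hμ.ae_le (ae_affine_ne hp b)] with x hx i hi
  exact gradient_potential fun j hj => (hi j).lt_of_ne (hx j i hj)

theorem aemeasurable_and_map_gradient_potential [Nonempty (Fin k)] (hμ : μ ≪ volume)
    (hp : Function.Injective p) (b : Fin k → ℝ) : AEMeasurable (gradient (potential p b)) μ ∧
      μ.map (gradient (potential p b)) = ∑ i, μ (cell p b i) • Measure.dirac (p i) := by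
  have hdisj : Pairwise (Function.onFun (AEDisjoint μ) fun i => cell p b i) := fun i j hij => by
    refine measure_mono_null (fun x hx => ?_) (ae_iff.mp (hμ.ae_le (ae_affine_ne hp b)))
    exact fun hne => hne i j hij (le_antisymm (hx.2 i) (hx.1 j))
  have hsum : Measure.sum (fun i => μ.restrict (cell p b i)) = μ := by
    rw [← Measure.restrict_iUnion_ae hdisj
      fun i => (measurableSet_cell p b i).nullMeasurableSet]
    rw [iUnion_eq_univ_iff.mpr (exists_mem_cell p b), Measure.restrict_univ]
  have hconst : ∀ i, gradient (potential p b) =ᵐ[μ.restrict (cell p b i)] fun _ => p i :=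
    fun i => (ae_restrict_iff' (measurableSet_cell p b i)).mpr
      ((ae_gradient_potential hμ hp b).mono fun x hx => hx i)
  have hmeas : AEMeasurable (gradient (potential p b))
      (Measure.sum fun i => μ.restrict (cell p b i)) :=
    AEMeasurable.sum_measure fun i => aemeasurable_const.congr (hconst i).symm
  refine ⟨hsum ▸ hmeas, ?_⟩
  calc μ.map (gradient (potential p b))
      = (Measure.sum fun i => μ.restrict (cell p b i)).map (gradient (potential p b)) := by
        rw [hsum]
    _ = ∑ i, μ (cell p b i) • Measure.dirac (p i) := by
        rw [Measure.map_sum hmeas, Measure.sum_fintype]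
        refine Finset.sum_congr rfl fun i _ => ?_
        rw [Measure.map_congr (hconst i), Measure.map_const, Measure.restrict_apply_univ]

theorem ae_mem_range_targetMeasure (p : Fin k → EuclideanSpace ℝ (Fin n)) (A : Fin k → ℝ) :
    ∀ᵐ y ∂targetMeasure p A, y ∈ range p := by
  rw [ae_iff, targetMeasure, Measure.finsetSum_apply]
  refine Finset.sum_eq_zero fun i _ => ?_
  have : Measure.dirac (p i) (range p)ᶜ = 0 := by
    rw [Measure.dirac_apply' _ (finite_range p).measurableSet.compl]
    simp
  rw [Measure.smul_apply, show {a | a ∉ range p} = (range p)ᶜ from rfl, this, smul_zero]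

end Basic

section FiniteMeasure

variable {n k : ℕ} [Nonempty (Fin k)] {p : Fin k → EuclideanSpace ℝ (Fin n)}
  {μ : Measure (EuclideanSpace ℝ (Fin n))} [IsFiniteMeasure μ]
  {Ω : Set (EuclideanSpace ℝ (Fin n))} {A : Fin k → ℝ}

theorem hasFDerivAt_reducedEnergy (hμ : μ ≪ volume) (hp : Function.Injective p) (hΩ : IsCompact Ω)
    (hμΩ : ∀ᵐ x ∂μ, x ∈ Ω) (h : Fin k → ℝ) :
    HasFDerivAt (reducedEnergy μ p A) (cellForm μ p h -
      ∑ i, A i • ContinuousLinearMap.proj (R := ℝ) (φ := fun _ : Fin k => ℝ) i) h :=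
  (hasFDerivAt_potentialIntegral hμ hp hΩ hμΩ h).sub (hasFDerivAt_sum_mul A h)

theorem convexOn_reducedEnergy (hΩ : IsCompact Ω) (hμΩ : ∀ᵐ x ∂μ, x ∈ Ω) :
    ConvexOn ℝ univ (reducedEnergy μ p A) := by
  refine (convexOn_potentialIntegral hΩ hμΩ).sub ⟨convex_univ, fun h _ h' _ s t _ _ _ => ?_⟩
  simp only [Pi.add_apply, Pi.smul_apply, smul_eq_mul, Finset.mul_sum, ← Finset.sum_add_distrib]
  exact (Finset.sum_congr rfl fun i _ => by ring).le

theorem reducedEnergy_le_of_measureReal_cell (hμ : μ ≪ volume) (hp : Function.Injective p)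
    (hΩ : IsCompact Ω) (hμΩ : ∀ᵐ x ∂μ, x ∈ Ω) {b : Fin k → ℝ}
    (hb : ∀ i, μ.real (cell p b i) = A i) (h : Fin k → ℝ) :
    reducedEnergy μ p A b ≤ reducedEnergy μ p A h := by
  refine (convexOn_reducedEnergy hΩ hμΩ).le_of_hasFDerivAt_zero ?_ h
  rw [← cellForm_sub_eq_zero_iff.mpr hb]
  exact hasFDerivAt_reducedEnergy hμ hp hΩ hμΩ b

theorem measureReal_cell_of_isLocalMin (hμ : μ ≪ volume) (hp : Function.Injective p)
    (hΩ : IsCompact Ω) (hμΩ : ∀ᵐ x ∂μ, x ∈ Ω) {b : Fin k → ℝ}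
    (hb : IsLocalMin (reducedEnergy μ p A) b) (i : Fin k) : μ.real (cell p b i) = A i :=
  cellForm_sub_eq_zero_iff.mp
    (hb.hasFDerivAt_eq_zero (hasFDerivAt_reducedEnergy hμ hp hΩ hμΩ b)) i

theorem reducedEnergy_add_const (hΩ : IsCompact Ω) (hμΩ : ∀ᵐ x ∂μ, x ∈ Ω)
    (hA : ∑ i, A i = μ.real univ) (h : Fin k → ℝ) (c : ℝ) :
    reducedEnergy μ p A (fun i => h i + c) = reducedEnergy μ p A h := by
  simp only [reducedEnergy, potentialIntegral_add_const hΩ hμΩ, add_mul, Finset.sum_add_distrib,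
    ← Finset.mul_sum, hA]
  ring

/-- The reduced energy controls the oscillation of the height vector. -/
theorem exists_mul_sub_le_reducedEnergy (hΩ : IsCompact Ω) (hμΩ : ∀ᵐ x ∂μ, x ∈ Ω)
    (hA_pos : ∀ i, 0 < A i) (hA : ∑ i, A i = μ.real univ) :
    ∃ C : ℝ, ∀ (h : Fin k → ℝ) (i j : Fin k),
      A j * (h i - h j) ≤ reducedEnergy μ p A h + C := by
  refine ⟨∑ i, |∫ x, inner ℝ x (p i) ∂μ|, fun h i j => ?_⟩
  -- Bounding the potential below by the affine piece of the largest height turns the energy, by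
  -- equality of total masses, into ∑ A_l (h_m - h_l) up to a bounded error. All these terms are
  -- nonnegative, so any single one is controlled.
  obtain ⟨m, hm⟩ := Finite.exists_max h
  have hi : ∀ {f : EuclideanSpace ℝ (Fin n) → ℝ}, Continuous f → Integrable f μ :=
    integrable_of_continuous_of_isCompact hΩ hμΩ
  have hpm : Integrable (fun x => inner ℝ x (p m)) μ := hi (by fun_prop)
  have h1 : ∫ x, inner ℝ x (p m) ∂μ + μ.real univ * h m ≤ potentialIntegral μ p h := by
    rw [← smul_eq_mul, ← integral_const, ← integral_add hpm (integrable_const _)]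
    exact integral_mono (hpm.add (integrable_const _)) (hi (continuous_potential p h)) fun x =>
      le_potential p h x m
  have h2 : -∑ i, |∫ x, inner ℝ x (p i) ∂μ| ≤ ∫ x, inner ℝ x (p m) ∂μ :=
    (neg_le_neg (Finset.single_le_sum (f := fun i => |∫ x, inner ℝ x (p i) ∂μ|)
      (fun i _ => abs_nonneg _) (Finset.mem_univ m))).trans (neg_abs_le _)
  have h3 : A j * (h m - h j) ≤ ∑ l, A l * (h m - h l) :=
    Finset.single_le_sum (f := fun l => A l * (h m - h l))
      (fun l _ => mul_nonneg (hA_pos l).le (sub_nonneg.mpr (hm l))) (Finset.mem_univ j)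
  have h4 : ∑ l, A l * (h m - h l) = μ.real univ * h m - ∑ l, h l * A l := by
    rw [← hA, Finset.sum_mul, ← Finset.sum_sub_distrib]
    exact Finset.sum_congr rfl fun l _ => by ring
  have h5 : A j * (h i - h j) ≤ A j * (h m - h j) :=
    mul_le_mul_of_nonneg_left (sub_le_sub_right (hm i) _) (hA_pos j).le
  rw [reducedEnergy]
  linarith

/-- Coercivity holds only modulo constant vectors, hence the slice h_{i₀} = 0. Invariance under
constants makes the minimum on the slice a global one, hence a critical point. -/
theorem exists_measureReal_cell_eq (hμ : μ ≪ volume) (hp : Function.Injective p)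
    (hΩ : IsCompact Ω) (hμΩ : ∀ᵐ x ∂μ, x ∈ Ω) (hA_pos : ∀ i, 0 < A i)
    (hA : ∑ i, A i = μ.real univ) : ∃ b : Fin k → ℝ, ∀ i, μ.real (cell p b i) = A i := by
  obtain ⟨i₀⟩ := ‹Nonempty (Fin k)›
  have : Nonempty (Fin k) := ⟨i₀⟩
  obtain ⟨C, hC⟩ := exists_mul_sub_le_reducedEnergy (p := p) hΩ hμΩ hA_pos hA
  obtain ⟨m, hm⟩ := Finite.exists_min A
  have hcont : Continuous (reducedEnergy μ p A) := continuous_iff_continuousAt.mpr fun h =>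
    (hasFDerivAt_reducedEnergy hμ hp hΩ hμΩ h).continuousAt
  have hnorm : ∀ h : Fin k → ℝ, h i₀ = 0 → A m * ‖h‖ ≤ reducedEnergy μ p A h + C := by
    intro h hh
    have hC0 : 0 ≤ reducedEnergy μ p A h + C := by simpa using hC h i₀ i₀
    rw [mul_comm, ← le_div_iff₀ (hA_pos m), pi_norm_le_iff_of_nonneg (div_nonneg hC0 (hA_pos m).le)]
    intro i
    rw [le_div_iff₀ (hA_pos m), mul_comm, Real.norm_eq_abs]
    rcases le_total 0 (h i) with hi | hi
    · rw [abs_of_nonneg hi]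
      have := hC h i i₀
      rw [hh, sub_zero] at this
      exact (mul_le_mul_of_nonneg_right (hm i₀) hi).trans this
    · rw [abs_of_nonpos hi]
      have := hC h i₀ i
      rw [hh, zero_sub] at this
      exact (mul_le_mul_of_nonneg_right (hm i) (neg_nonneg.mpr hi)).trans this
  obtain ⟨b, -, hb⟩ := hcont.continuousOn.exists_isMinOn'
    (isClosed_eq (continuous_apply i₀) continuous_const : IsClosed {h : Fin k → ℝ | h i₀ = 0})
    (x₀ := 0) rfl (by
      -- Beyond this radius `hnorm` forces the energy on the slice to be at least its value at 0.
      have hlarge := (tendsto_norm_cocompact_atTop (E := Fin k → ℝ)).eventually_ge_atTop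
        ((reducedEnergy μ p A 0 + C) / A m)
      filter_upwards [hlarge.filter_mono inf_le_left, mem_inf_of_right (mem_principal_self _)]
        with h h1 h2
      rw [div_le_iff₀ (hA_pos m), mul_comm] at h1
      linarith [hnorm h h2])
  refine ⟨b, measureReal_cell_of_isLocalMin hμ hp hΩ hμΩ (Eventually.of_forall fun h => ?_)⟩
  rw [← reducedEnergy_add_const hΩ hμΩ hA h (-h i₀)]
  exact hb (by simp : h i₀ + -h i₀ = 0)

theorem reducedEnergy_combo_lt (hΩ : IsCompact Ω) (hconv : Convex ℝ Ω) (hμΩ : ∀ᵐ x ∂μ, x ∈ Ω)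
    (hΩμ : volume.restrict Ω ≪ μ) {h h' : Fin k → ℝ} (hh : h ∈ admissible Ω p)
    (hh' : h' ∈ admissible Ω p) {s t : ℝ} (hs : 0 < s) (ht : 0 < t) (hst : s + t = 1)
    (hne : ¬∃ c, ∀ i, h i - h' i = c) :
    reducedEnergy μ p A (s • h + t • h') <
      s * reducedEnergy μ p A h + t * reducedEnergy μ p A h' := by
  by_contra! hle
  refine hne (exists_sub_eq_const_of_potentialIntegral_combo hΩ hconv hμΩ hΩμ hh hh' hs ht hst ?_)
  have hlin : ∑ i, (s • h + t • h') i * A i = s * ∑ i, h i * A i + t * ∑ i, h' i * A i := by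
    rw [Finset.mul_sum, Finset.mul_sum, ← Finset.sum_add_distrib]
    exact Finset.sum_congr rfl fun i _ => by
      simp only [Pi.add_apply, Pi.smul_apply, smul_eq_mul]; ring
  simp only [reducedEnergy, hlin] at hle
  linarith

/-- Both vectors are global minimizers; if they did not differ by a constant, their midpoint would
have smaller energy. -/
theorem exists_sub_eq_const_of_measureReal_cell (hμ : μ ≪ volume) (hp : Function.Injective p)
    (hΩ : IsCompact Ω) (hconv : Convex ℝ Ω) (hμΩ : ∀ᵐ x ∂μ, x ∈ Ω)
    (hΩμ : volume.restrict Ω ≪ μ) {h h' : Fin k → ℝ} (hh : h ∈ admissible Ω p)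
    (hh' : h' ∈ admissible Ω p) (hA : ∀ i, μ.real (cell p h i) = A i)
    (hA' : ∀ i, μ.real (cell p h' i) = A i) : ∃ c, ∀ i, h i - h' i = c := by
  by_contra hne
  have hlt := reducedEnergy_combo_lt (A := A) hΩ hconv hμΩ hΩμ hh hh'
    (s := 1 / 2) (t := 1 / 2) (by norm_num) (by norm_num) (by norm_num) hne
  have h1 := reducedEnergy_le_of_measureReal_cell hμ hp hΩ hμΩ hA
    ((1 / 2 : ℝ) • h + (1 / 2 : ℝ) • h')
  have h2 := reducedEnergy_le_of_measureReal_cell hμ hp hΩ hμΩ hA' h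
  linarith

theorem quadraticCost_le_of_map_eq (hΩ : IsCompact Ω) (hμΩ : ∀ᵐ x ∂μ, x ∈ Ω)
    (hp : Function.Injective p) (b : Fin k → ℝ)
    {S T : EuclideanSpace ℝ (Fin n) → EuclideanSpace ℝ (Fin n)} (hS : AEMeasurable S μ)
    (hT : AEMeasurable T μ) (hmap : μ.map S = μ.map T)
    (hScell : ∀ᵐ x ∂μ, ∃ i, x ∈ cell p b i ∧ S x = p i) (hTrange : ∀ᵐ x ∂μ, T x ∈ range p) :
    quadraticCost μ S ≤ quadraticCost μ T := by
  set f : EuclideanSpace ℝ (Fin n) → ℝ := fun x => 2 * potential p b x - ‖x‖ ^ 2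
  have hf : Continuous f :=
    (continuous_const.mul (continuous_potential p b)).sub (continuous_norm.pow 2)
  obtain ⟨C, hC⟩ := hΩ.exists_bound_of_continuousOn hf.continuousOn
  -- Only the values at the p_i matter; they form the dual potential on the target, extended by 0 to
  -- a measurable function.
  set φ : EuclideanSpace ℝ (Fin n) → ℝ := fun y =>
    ∑ i, ({p i} : Set (EuclideanSpace ℝ (Fin n))).indicator (fun _ => ‖p i‖ ^ 2 + 2 * b i) y
    with hφ
  have hφp : ∀ i, φ (p i) = ‖p i‖ ^ 2 + 2 * b i := fun i => by
    rw [hφ]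
    dsimp only
    rw [Finset.sum_eq_single i (fun j _ hj => indicator_of_notMem
      (s := {p j}) (fun h => hj (hp h).symm) _) (by simp), indicator_of_mem (mem_singleton _)]
  have hφm : Measurable fun y => ENNReal.ofReal (φ y + C) := by
    refine ENNReal.measurable_ofReal.comp (Measurable.add_const ?_ C)
    exact Finset.measurable_fun_sum _ fun i _ =>
      measurable_const.indicator (measurableSet_singleton _)
  -- The shift by C makes f nonnegative on Ω, so the comparison can be made with lower integrals; g
  -- has finite integral and cancels at the end.
  set g : EuclideanSpace ℝ (Fin n) → ENNReal := fun x => ENNReal.ofReal (f x + C)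
  have hgm : Measurable g := ENNReal.measurable_ofReal.comp (hf.measurable.add_const C)
  have hf0 : ∀ x ∈ Ω, 0 ≤ f x + C := fun x hx => by linarith [(abs_le.mp (hC x hx)).1]
  have hgfin : ∫⁻ x, g x ∂μ ≠ ⊤ :=
    ((integrable_of_continuous_of_isCompact hΩ hμΩ
      (hf.add continuous_const)).lintegral_lt_top).ne
  have hexp : ∀ x i, ‖x - p i‖ ^ 2 + f x =
      φ (p i) + 2 * (potential p b x - (inner ℝ x (p i) + b i)) := fun x i => by
    rw [hφp, norm_sub_sq_real]
    simp only [f]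
    ring
  have hSle : quadraticCost μ S + ∫⁻ x, g x ∂μ ≤ ∫⁻ x, ENNReal.ofReal (φ (S x) + C) ∂μ := by
    rw [quadraticCost, ← lintegral_add_right _ hgm]
    refine lintegral_mono_ae ?_
    filter_upwards [hμΩ, hScell] with x hx ⟨i, hi, hSi⟩
    rw [← ENNReal.ofReal_add (by positivity) (hf0 x hx), hSi, ← add_assoc, hexp,
      potential_eq_of_mem_cell hi, sub_self, mul_zero, add_zero]
  have hTle : ∫⁻ x, ENNReal.ofReal (φ (T x) + C) ∂μ ≤ quadraticCost μ T + ∫⁻ x, g x ∂μ := by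
    rw [quadraticCost, ← lintegral_add_right _ hgm]
    refine lintegral_mono_ae ?_
    filter_upwards [hμΩ, hTrange] with x hx ⟨i, hTi⟩
    rw [← ENNReal.ofReal_add (by positivity) (hf0 x hx), ← hTi, ← add_assoc, hexp]
    refine ENNReal.ofReal_le_ofReal ?_
    linarith [le_potential p b x i]
  have hST : ∫⁻ x, ENNReal.ofReal (φ (S x) + C) ∂μ = ∫⁻ x, ENNReal.ofReal (φ (T x) + C) ∂μ := by
    rw [← lintegral_map' hφm.aemeasurable hS, hmap, lintegral_map' hφm.aemeasurable hT]
  exact ENNReal.le_of_add_le_add_right hgfin (hSle.trans (hST.trans_le hTle))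

end FiniteMeasure

/-! ### The source measure σ dx on Ω -/

section Source

variable {n k : ℕ} {Ω : Set (EuclideanSpace ℝ (Fin n))} {σ : EuclideanSpace ℝ (Fin n) → ℝ}

theorem isFiniteMeasure_sourceMeasure (hΩ : IsCompact Ω) (hσ : ContinuousOn σ Ω) :
    IsFiniteMeasure (sourceMeasure Ω σ) :=
  isFiniteMeasure_withDensity_ofReal (hσ.integrableOn_compact hΩ).2

theorem sourceMeasure_absolutelyContinuous_restrict :
    sourceMeasure Ω σ ≪ volume.restrict Ω :=
  withDensity_absolutelyContinuous _ _

theorem sourceMeasure_absolutelyContinuous : sourceMeasure Ω σ ≪ volume :=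
  sourceMeasure_absolutelyContinuous_restrict.trans Measure.restrict_le_self.absolutelyContinuous

theorem ae_mem_sourceMeasure (hΩ : IsCompact Ω) : ∀ᵐ x ∂sourceMeasure Ω σ, x ∈ Ω :=
  sourceMeasure_absolutelyContinuous_restrict.ae_le (ae_restrict_mem hΩ.measurableSet)

theorem restrict_absolutelyContinuous_sourceMeasure (hΩ : IsCompact Ω) (hσ : ContinuousOn σ Ω)
    (hσ_pos : ∀ x ∈ Ω, 0 < σ x) : volume.restrict Ω ≪ sourceMeasure Ω σ := by
  refine withDensity_absolutelyContinuous' (hσ.aemeasurable hΩ.measurableSet).ennreal_ofReal ?_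
  filter_upwards [ae_restrict_mem hΩ.measurableSet] with x hx
  simpa using hσ_pos x hx

theorem sourceMeasure_real_apply (hΩ : IsCompact Ω) (hσ : ContinuousOn σ Ω)
    (hσ_pos : ∀ x ∈ Ω, 0 < σ x) {s : Set (EuclideanSpace ℝ (Fin n))} (hs : MeasurableSet s) :
    (sourceMeasure Ω σ).real s = ∫ x in s ∩ Ω, σ x := by
  have hsΩ : MeasurableSet (s ∩ Ω) := hs.inter hΩ.measurableSet
  rw [Measure.real, sourceMeasure, withDensity_apply _ hs, Measure.restrict_restrict hs,
    integral_eq_lintegral_of_nonneg_ae]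
  · exact (ae_restrict_mem hsΩ).mono fun x hx => (hσ_pos x hx.2).le
  · exact (hσ.mono inter_subset_right).aestronglyMeasurable hsΩ

/-- As σ is positive on Ω, volume on Ω and the source measure have the same null sets. Openness of H
then follows from continuity of the cell masses. -/
theorem admissible_eq (hΩ : IsCompact Ω) (hσ : ContinuousOn σ Ω) (hσ_pos : ∀ x ∈ Ω, 0 < σ x)
    (p : Fin k → EuclideanSpace ℝ (Fin n)) :
    admissible Ω p = {h | ∀ i, 0 < sourceMeasure Ω σ (cell p h i)} := by
  ext h
  refine forall_congr' fun i => ?_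
  rw [← Measure.restrict_apply (measurableSet_cell p h i), pos_iff_ne_zero, pos_iff_ne_zero]
  exact not_congr ⟨fun h0 => sourceMeasure_absolutelyContinuous_restrict h0,
    fun h0 => restrict_absolutelyContinuous_sourceMeasure hΩ hσ hσ_pos h0⟩

end Source

end SemiDiscreteOT

end

/-! ### The main theorem -/

theorem theorem1p2 {n k : ℕ} (hk : 0 < k)
    (Ω : Set (EuclideanSpace ℝ (Fin n))) (hΩ_compact : IsCompact Ω) (hΩ_convex : Convex ℝ Ω)
    (p : Fin k → EuclideanSpace ℝ (Fin n)) (hp : Function.Injective p)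
    (σ : EuclideanSpace ℝ (Fin n) → ℝ) (hσ_cont : ContinuousOn σ Ω) (hσ_pos : ∀ x ∈ Ω, 0 < σ x)
    (A : Fin k → ℝ) (hA_pos : ∀ i, 0 < A i) (hA_sum : ∑ i, A i = ∫ x in Ω, σ x) :
    -- existence of `b`, and uniqueness up to adding a constant vector
    (∃ b : Fin k → ℝ, ∀ b' : Fin k → ℝ,
      (∀ i, SemiDiscreteOT.cellMass Ω p σ b' i = A i) ↔ ∃ c : ℝ, b' = fun i => b i + c) ∧
    -- `H` is open and convex
    IsOpen (SemiDiscreteOT.admissible Ω p) ∧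
    Convex ℝ (SemiDiscreteOT.admissible Ω p) ∧
    -- for every base point `a` in `H`
    (∀ a ∈ SemiDiscreteOT.admissible Ω p,
      -- the line integral defining the energy does not depend on the path in `H`
      (∀ h ∈ SemiDiscreteOT.admissible Ω p, ∀ γ : Path a h,
        (∀ t, γ t ∈ SemiDiscreteOT.admissible Ω p) →
        ContDiffOn ℝ 1 γ.extend (Set.Icc 0 1) →
          CurveIntegrable (SemiDiscreteOT.massForm Ω p σ) γ ∧
          curveIntegral (SemiDiscreteOT.massForm Ω p σ) γ - ∑ i, h i * A i =
            SemiDiscreteOT.energy Ω p σ A a h) ∧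
      -- the energy is convex on `H`, and strictly convex on `H₀`
      ConvexOn ℝ (SemiDiscreteOT.admissible Ω p) (SemiDiscreteOT.energy Ω p σ A a) ∧
      StrictConvexOn ℝ (SemiDiscreteOT.admissible Ω p ∩ {h | ∑ i, h i = 0})
        (SemiDiscreteOT.energy Ω p σ A a) ∧
      -- the solutions `b` are exactly the minimum points of the energy on `H`
      (∀ b : Fin k → ℝ, (∀ i, SemiDiscreteOT.cellMass Ω p σ b i = A i) ↔
        b ∈ SemiDiscreteOT.admissible Ω p ∧
          IsMinOn (SemiDiscreteOT.energy Ω p σ A a) (SemiDiscreteOT.admissible Ω p) b)) ∧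
    -- `∇ u_b` is a transport map, of minimal quadratic cost among all transport maps
    (∀ b : Fin k → ℝ, (∀ i, SemiDiscreteOT.cellMass Ω p σ b i = A i) →
      SemiDiscreteOT.IsTransportMap (SemiDiscreteOT.sourceMeasure Ω σ)
        (SemiDiscreteOT.targetMeasure p A) (gradient (SemiDiscreteOT.potential p b)) ∧
      ∀ T : EuclideanSpace ℝ (Fin n) → EuclideanSpace ℝ (Fin n),
        SemiDiscreteOT.IsTransportMap (SemiDiscreteOT.sourceMeasure Ω σ)
          (SemiDiscreteOT.targetMeasure p A) T →
        SemiDiscreteOT.quadraticCost (SemiDiscreteOT.sourceMeasure Ω σ)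
            (gradient (SemiDiscreteOT.potential p b)) ≤
          SemiDiscreteOT.quadraticCost (SemiDiscreteOT.sourceMeasure Ω σ) T) := by

  have : Nonempty (Fin k) := ⟨⟨0, hk⟩⟩
  set μ := SemiDiscreteOT.sourceMeasure Ω σ with hμdef
  have : IsFiniteMeasure μ := SemiDiscreteOT.isFiniteMeasure_sourceMeasure hΩ_compact hσ_cont
  have hμ : μ ≪ volume := SemiDiscreteOT.sourceMeasure_absolutelyContinuous
  have hμΩ : ∀ᵐ x ∂μ, x ∈ Ω := SemiDiscreteOT.ae_mem_sourceMeasure hΩ_compact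
  have hΩμ : volume.restrict Ω ≪ μ :=
    SemiDiscreteOT.restrict_absolutelyContinuous_sourceMeasure hΩ_compact hσ_cont hσ_pos
  have hmass : ∀ h i, SemiDiscreteOT.cellMass Ω p σ h i = μ.real (SemiDiscreteOT.cell p h i) :=
    fun h i => (SemiDiscreteOT.sourceMeasure_real_apply hΩ_compact hσ_cont hσ_pos
      (SemiDiscreteOT.measurableSet_cell p h i)).symm
  have hform : SemiDiscreteOT.massForm Ω p σ = SemiDiscreteOT.cellForm μ p := by
    ext1 h
    simp only [SemiDiscreteOT.massForm, SemiDiscreteOT.cellForm, hmass]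
  have hA : ∑ i, A i = μ.real univ := by
    rw [hA_sum, hμdef, SemiDiscreteOT.sourceMeasure_real_apply hΩ_compact hσ_cont hσ_pos .univ,
      univ_inter]
  have hadm := SemiDiscreteOT.admissible_eq hΩ_compact hσ_cont hσ_pos p
  have hmem : ∀ b, (∀ i, SemiDiscreteOT.cellMass Ω p σ b i = A i) →
      b ∈ SemiDiscreteOT.admissible Ω p := fun b hb => by
    rw [hadm]
    intro i
    have hpos : 0 < μ.real (SemiDiscreteOT.cell p b i) := by
      rw [← hmass, hb]; exact hA_pos i
    exact (ENNReal.toReal_pos_iff.mp hpos).1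
  have hopen : IsOpen (SemiDiscreteOT.admissible Ω p) := by
    rw [hadm, ofPred_forall]
    exact isOpen_iInter_of_finite fun i =>
      isOpen_lt continuous_const (SemiDiscreteOT.continuous_measure_cell hμ hp i)
  have hconv := SemiDiscreteOT.convex_admissible p hΩ_convex
  have hcurve : ∀ {a h : Fin k → ℝ} {γ : Path a h}, ContDiffOn ℝ 1 γ.extend (Icc 0 1) →
      CurveIntegrable (SemiDiscreteOT.massForm Ω p σ) γ ∧
      curveIntegral (SemiDiscreteOT.massForm Ω p σ) γ =
        SemiDiscreteOT.potentialIntegral μ p h - SemiDiscreteOT.potentialIntegral μ p a := by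
    intro a h γ hγ
    rw [hform]
    exact curveIntegral_eq_sub_of_hasFDerivAt
      (SemiDiscreteOT.hasFDerivAt_potentialIntegral hμ hp hΩ_compact hμΩ)
      (SemiDiscreteOT.continuous_cellForm hμ hp) hγ
  -- The base point enters only through an additive constant, so every claim about E reduces to the
  -- reduced energy.
  have henergy : ∀ a, SemiDiscreteOT.energy Ω p σ A a = fun h =>
      SemiDiscreteOT.reducedEnergy μ p A h + -SemiDiscreteOT.potentialIntegral μ p a := by
    intro a
    ext h
    have hseg : ContDiffOn ℝ 1 (Path.segment a h).extend (Icc 0 1) := by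
      refine ContDiffOn.congr (f := fun t : ℝ => t • (h - a) + a) (by fun_prop) fun t ht => ?_
      rw [Path.extend_apply _ ht, Path.segment_apply, AffineMap.lineMap_apply_module']
    rw [SemiDiscreteOT.energy, (hcurve hseg).2, SemiDiscreteOT.reducedEnergy]
    ring
  have hconvE := SemiDiscreteOT.convexOn_reducedEnergy (p := p) (A := A) hΩ_compact hμΩ
  refine ⟨?_, hopen, hconv, fun a ha => ⟨fun h hh γ hγmem hγ => ?_, ?_, ?_, fun b => ?_⟩,
    fun b hb => ?_⟩
  · obtain ⟨b, hb⟩ :=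
      SemiDiscreteOT.exists_measureReal_cell_eq hμ hp hΩ_compact hμΩ hA_pos hA
    refine ⟨b, fun b' => ⟨fun hb' => ?_, ?_⟩⟩
    · obtain ⟨c, hc⟩ := SemiDiscreteOT.exists_sub_eq_const_of_measureReal_cell hμ hp hΩ_compact
        hΩ_convex hμΩ hΩμ (hmem b' hb') (hmem b fun i => (hmass b i).trans (hb i))
        (fun i => (hmass b' i).symm.trans (hb' i)) hb
      exact ⟨c, funext fun i => by linarith [hc i]⟩
    · rintro ⟨c, rfl⟩ i
      rw [hmass, SemiDiscreteOT.cell_add_const, hb]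
  · refine ⟨(hcurve hγ).1, ?_⟩
    simp only [(hcurve hγ).2, henergy, SemiDiscreteOT.reducedEnergy]
    ring
  · rw [henergy]
    exact (hconvE.subset (subset_univ _) hconv).add_const _
  · refine ⟨hconv.inter fun h hh h' hh' s t _ _ _ => ?_, fun h hh h' hh' hne s t hs ht hst => ?_⟩
    · simp only [mem_ofPred_eq] at hh hh' ⊢
      simp [Finset.sum_add_distrib, ← Finset.mul_sum, hh, hh']
    -- On the hyperplane ∑ h_i = 0 a constant difference c satisfies k c = 0.
    · have hnc : ¬∃ c, ∀ i, h i - h' i = c := by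
        rintro ⟨c, hc⟩
        refine hne (funext fun i => ?_)
        have hsum : ∑ i, (h i - h' i) = 0 := by
          rw [Finset.sum_sub_distrib, hh.2, hh'.2, sub_self]
        simp only [hc, Finset.sum_const, Finset.card_univ, Fintype.card_fin, nsmul_eq_mul,
          mul_eq_zero, Nat.cast_eq_zero, hk.ne', false_or] at hsum
        linarith [hc i]
      have hlt := SemiDiscreteOT.reducedEnergy_combo_lt (A := A) hΩ_compact hΩ_convex hμΩ hΩμ
        hh.1 hh'.1 hs ht hst hnc
      have hE : SemiDiscreteOT.potentialIntegral μ p a =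
          s * SemiDiscreteOT.potentialIntegral μ p a +
            t * SemiDiscreteOT.potentialIntegral μ p a := by rw [← add_mul, hst, one_mul]
      simp only [henergy, smul_eq_mul]
      linarith
  · rw [henergy]
    constructor
    · refine fun hb => ⟨hmem b hb, fun h _ => ?_⟩
      exact add_le_add_left (SemiDiscreteOT.reducedEnergy_le_of_measureReal_cell hμ hp hΩ_compact
        hμΩ (fun i => (hmass b i).symm.trans (hb i)) h) _
    · rintro ⟨hbH, hmin⟩ i
      rw [hmass]
      refine SemiDiscreteOT.measureReal_cell_of_isLocalMin hμ hp hΩ_compact hμΩ ?_ i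
      -- Because H is open, a minimum over H is a local minimum in ℝᵏ, so the derivative vanishes
      -- there.
      exact (hmin.isLocalMin (hopen.mem_nhds hbH)).mono fun h hh => le_of_add_le_add_right hh
  · obtain ⟨hgm, hgmap⟩ := SemiDiscreteOT.aemeasurable_and_map_gradient_potential hμ hp b
    have htarget : ∑ i, μ (SemiDiscreteOT.cell p b i) • Measure.dirac (p i) =
        SemiDiscreteOT.targetMeasure p A := by
      refine Finset.sum_congr rfl fun i _ => ?_
      rw [← hb i, hmass, ofReal_measureReal]
    refine ⟨⟨hgm, hgmap.trans htarget⟩, fun T hT => ?_⟩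
    refine SemiDiscreteOT.quadraticCost_le_of_map_eq hΩ_compact hμΩ hp b hgm hT.1
      ((hgmap.trans htarget).trans hT.2.symm) ?_ ?_
    · filter_upwards [SemiDiscreteOT.ae_gradient_potential hμ hp b] with x hx
      obtain ⟨i, hi⟩ := SemiDiscreteOT.exists_mem_cell p b x
      exact ⟨i, hi, hx i hi⟩
    · exact ae_of_ae_map hT.1 (hT.2 ▸ SemiDiscreteOT.ae_mem_range_targetMeasure p A)
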